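/- Let $\Bbbk$ be a field and let $\mathcal P=(\mathcal P(n))_{n\ge 0}$ be a symmetric operad in $\Bbbk$-vector spaces, with right $\mathbb S_n$-actions, partial compositions $\circ_i$ and identity $\mathbf 1\in\mathcal P(1)$. Definitions. $\mathcal P$ is *2-unitary* if $\mathcal P(0)=\Bbbk \mathbf 1_0$ is one-dimensional and there is $\mathbf 1_2\in\mathcal P(2)$ with $\mathbf 1_2\circ_1\mathbf 1_0=\mathbf 1=\mathbf 1_2\circ_2\mathbf 1_0$. A family $I=(I(n))_{n\ge0}$ of $\mathbb S_n$-submodules $I(n)\subseteq\mathcal P(n)$ is a *left ideal* if $\mu\circ_i x\in I$, a *right ideal* if $x\circ_i\mu\in I$, for all $\mu\in\mathcal P$, $x\in I$ and all $i$, and an *ideal* if it is both. $\mathcal P$ is *left (right) artinian* if every descending chain of left (right) ideals stabilizes, and *semiprime* if every ideal $I$ with $x\circ_i y=0$ for all $x,y\in I$ and all $i$ is zero. A *derivation* of $\mathcal P$ is a family of linear maps $\partial:\mathcal P(n)\to\mathcal P(n)$ commuting with the $\mathbb S_n$-actions and satisfying $\partial(\mu\circ_i\nu)=\partial(\mu)\circ_i\nu+\mu\circ_i\partial(\nu)$;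 it is *inner* if for some $\lambda\in\mathcal P(1)$ one has $\partial(\theta)=\lambda\circ_1\theta-\sum_{i=1}^n\theta\circ_i\lambda$ for all $n$ and all $\theta\in\mathcal P(n)$. Under the commutator the derivations form a Lie algebra $\mathrm{Der}(\mathcal P)$, and the inner ones a Lie ideal $\mathrm{IDer}(\mathcal P)$; put $H^1(\mathcal P)=\mathrm{Der}(\mathcal P)/\mathrm{IDer}(\mathcal P)$. For a possibly nonunital associative algebra $B$, $\mathrm{Der}(B)$ is the Lie algebra of its derivations and $HH^1(B)$ is the quotient of $\mathrm{Der}(B)$ by the inner derivations $x\mapsto bx-xb$, $b\in B$. If $\mathcal P$ is 2-unitary, the algebra $\mathcal P(1)$ (with product $\circ_1$) has the augmentation $\varepsilon$ given by $a\circ_1\mathbf 1_0=\varepsilon(a)\mathbf 1_0$; let $\bar A=\ker\varepsilon$ be its augmentation ideal. **Theorem.** Let $\mathcal P$ be a 2-unitary operad over $\Bbbk$ that is left artinian or right artinian, and semiprime. Then there is a short exact sequence of Lie algebras $$0\to\Bbbk\xrightarrow{\ \iota\ }\mathrm{Der}(\mathcal P)\xrightarrow{\ \rho\ }\mathrm{Der}(\bar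 A)\to0,$$ where $\Bbbk$ is the one-dimensional abelian Lie algebra, $\iota(c)$ is the derivation $\theta\mapsto(n-1)c\,\theta$ for $\theta\in\mathcal P(n)$, and $\rho(\partial)=\partial|_{\bar A}$. Consequently, there is a Lie algebra isomorphism $\mathrm{Der}(\mathcal P)\cong\Bbbk\rtimes\mathrm{Der}(\bar A)$ compatible with $\iota$ and $\rho$, and $\rho$ induces an isomorphism of Lie algebras (in particular of vector spaces) $H^1(\mathcal P)\cong HH^1(\bar A)$. -/

import Mathlib

universe u v

attribute [local instance] LieRing.ofAssociativeRing

/-! ## Inserting a block in place of one letter -/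

/-- Positions of the `r = m + n - 1` inputs of `μ ∘ᵢ ν` (`μ` of arity `m`, `ν` of arity `n`,
all positions counted from `0`).  The input `t` of `ν` sits at position `i + t`; the input
`q ≠ i` of `μ` sits at position `q` if `q < i`, and at position `q + n - 1` if `q > i`. -/
def blockPos {m n r : ℕ} (i : Fin m) (h : r + 1 = m + n) :
    Fin n ⊕ {q : Fin m // q ≠ i} → Fin r
  | Sum.inl t => ⟨i + t, by omega⟩
  | Sum.inr q =>
      ⟨if q.1 < i then (q.1 : ℕ) else q.1 + n - 1, by
        have h1 : (q.1 : ℕ) ≠ i := fun e => q.2 (Fin.ext e)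
        split_ifs with hq
        · have : (q.1 : ℕ) < i := hq
          omega
        · have : ¬ (q.1 : ℕ) < i := hq
          omega⟩

theorem blockPos_bijective {m n r : ℕ} (i : Fin m) (h : r + 1 = m + n) :
    Function.Bijective (blockPos i h) := by
  rw [Fintype.bijective_iff_injective_and_card]
  constructor
  · rintro (a | ⟨a, ha⟩) (b | ⟨b, hb⟩) hab
    · have := congrArg Fin.val hab
      simp only [blockPos] at this
      congr 1
      exact Fin.ext (by omega)
    · have := congrArg Fin.val hab
      have hb' : (b : ℕ) ≠ i := fun e => hb (Fin.ext e)
      simp only [blockPos, Fin.lt_def] at this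
      split_ifs at this <;> omega
    · have := congrArg Fin.val hab
      have ha' : (a : ℕ) ≠ i := fun e => ha (Fin.ext e)
      simp only [blockPos, Fin.lt_def] at this
      split_ifs at this <;> omega
    · have := congrArg Fin.val hab
      have ha' : (a : ℕ) ≠ i := fun e => ha (Fin.ext e)
      have hb' : (b : ℕ) ≠ i := fun e => hb (Fin.ext e)
      simp only [blockPos, Fin.lt_def] at this
      have : (a : ℕ) = b := by split_ifs at this <;> omega
      congr 2
      exact Fin.ext this
  · have h1 : Fintype.card {q : Fin m // q ≠ i} = m - 1 := by
      simp [Fintype.card_subtype_compl]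
    rw [Fintype.card_sum, h1, Fintype.card_fin, Fintype.card_fin]
    have := i.2
    omega

noncomputable def blockEquiv {m n r : ℕ} (i : Fin m) (h : r + 1 = m + n) :
    Fin n ⊕ {q : Fin m // q ≠ i} ≃ Fin r :=
  Equiv.ofBijective (blockPos i h) (blockPos_bijective i h)

/-- The permutation `σ' = 1ₘ ∘ᵢ σ` of `m + n - 1` letters: it permutes the block of the
`n` inputs starting at `i` by `σ` and fixes everything else. -/
noncomputable def permInner {m n r : ℕ} (i : Fin m) (h : r + 1 = m + n)
    (σ : Equiv.Perm (Fin n)) : Equiv.Perm (Fin r) :=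
  (blockEquiv i h).symm.trans
    ((Equiv.sumCongr σ (Equiv.refl {q : Fin m // q ≠ i})).trans (blockEquiv i h))

/-- The permutation `φ'' = φ ∘ᵢ 1ₙ` of `m + n - 1` letters: it moves the block of `n` letters in
place of the letter `i` to the block in place of `φ i`, keeping the order inside the block, and
permutes the other letters as `φ` does. -/
noncomputable def permOuter {m n r : ℕ} (i : Fin m) (h : r + 1 = m + n)
    (φ : Equiv.Perm (Fin m)) : Equiv.Perm (Fin r) :=
  (blockEquiv i h).symm.trans
    ((Equiv.sumCongr (Equiv.refl (Fin n))
      (φ.subtypeEquiv (fun q => by simp) :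
        {q : Fin m // q ≠ i} ≃ {q : Fin m // q ≠ φ i})).trans (blockEquiv (φ i) h))

/-! ## Operads -/

/-- A symmetric operad over `𝕜`, by partial compositions.  The partial composition
`comp i h μ ν = μ ∘ᵢ ν` lands in arity `r = m + n - 1`, which is expressed by `h : r + 1 = m + n`
(there is such an `i : Fin m` only if `m ≥ 1`, and then `r` is determined).  Inputs are numbered
from `0`.  `act σ θ` is the right action `θ ∗ σ` of the symmetric group. -/
structure SymmOperad (𝕜 : Type u) [CommRing 𝕜] where
  obj : ℕ → Type v
  [addCommGroup : ∀ n, AddCommGroup (obj n)]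
  [module : ∀ n, Module 𝕜 (obj n)]
  act : ∀ {n : ℕ}, Equiv.Perm (Fin n) → (obj n →ₗ[𝕜] obj n)
  act_one : ∀ {n : ℕ} (θ : obj n), act 1 θ = θ
  act_mul : ∀ {n : ℕ} (σ τ : Equiv.Perm (Fin n)) (θ : obj n), act (σ * τ) θ = act τ (act σ θ)
  one : obj 1
  comp : ∀ {m n r : ℕ} (_ : Fin m) (_ : r + 1 = m + n), obj m →ₗ[𝕜] obj n →ₗ[𝕜] obj r
  /-- `θ ∘ᵢ 𝟙 = θ` -/
  comp_one : ∀ {n : ℕ} (i : Fin n) (θ : obj n), comp i rfl θ one = θ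
  /-- `𝟙 ∘₁ θ = θ` -/
  one_comp : ∀ {n : ℕ} (θ : obj n), comp 0 (Nat.add_comm n 1) one θ = θ
  /-- `(l ∘ᵢ μ) ∘_{i-1+j} ν = l ∘ᵢ (μ ∘ⱼ ν)` -/
  comp_assoc : ∀ {l m n r s t : ℕ} (i : Fin l) (j : Fin m) (p : Fin r)
    (h₁ : r + 1 = l + m) (h₂ : t + 1 = r + n) (h₃ : s + 1 = m + n) (h₄ : t + 1 = l + s)
    (_ : (p : ℕ) = i + j) (lam : obj l) (μ : obj m) (ν : obj n),
    comp p h₂ (comp i h₁ lam μ) ν = comp i h₄ lam (comp j h₃ μ ν)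
  /-- `(l ∘ᵢ μ) ∘_{k-1+m} ν = (l ∘ₖ ν) ∘ᵢ μ` for `i < k` -/
  comp_comm : ∀ {l m n r s t : ℕ} (i k : Fin l) (p : Fin r) (q : Fin s)
    (h₁ : r + 1 = l + m) (h₂ : t + 1 = r + n) (h₃ : s + 1 = l + n) (h₄ : t + 1 = s + m)
    (_ : i < k) (_ : (p : ℕ) + 1 = k + m) (_ : (q : ℕ) = i)
    (lam : obj l) (μ : obj m) (ν : obj n),
    comp p h₂ (comp i h₁ lam μ) ν = comp q h₄ (comp k h₃ lam ν) μ
  /-- `μ ∘ᵢ (ν ∗ σ) = (μ ∘ᵢ ν) ∗ σ'` -/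
  comp_act : ∀ {m n r : ℕ} (i : Fin m) (h : r + 1 = m + n) (σ : Equiv.Perm (Fin n))
    (μ : obj m) (ν : obj n),
    comp i h μ (act σ ν) = act (permInner i h σ) (comp i h μ ν)
  /-- `(μ ∗ φ) ∘ᵢ ν = (μ ∘_{φ(i)} ν) ∗ φ''` -/
  act_comp : ∀ {m n r : ℕ} (i : Fin m) (h : r + 1 = m + n) (φ : Equiv.Perm (Fin m))
    (μ : obj m) (ν : obj n),
    comp i h (act φ μ) ν = act (permOuter i h φ) (comp (φ i) h μ ν)

attribute [instance] SymmOperad.addCommGroup SymmOperad.module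

/-! ## Derivations and Hochschild cohomology of nonunital associative algebras -/

section NonUnital

variable (𝕜 : Type u) [CommRing 𝕜] (B : Type v) [NonUnitalRing B] [Module 𝕜 B]
  [IsScalarTower 𝕜 B B] [SMulCommClass 𝕜 B B]

/-- The Lie algebra (under the commutator) of derivations of an associative, possibly
nonunital and noncommutative, algebra `B`. -/
def algDer : LieSubalgebra 𝕜 (Module.End 𝕜 B) where
  carrier := {D | ∀ a b, D (a * b) = D a * b + a * D b}
  zero_mem' := by intro a b; simp
  add_mem' := by
    intro D E hD hE a b
    simp only [LinearMap.add_apply, hD a b, hE a b, add_mul, mul_add]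
    abel
  smul_mem' := by
    intro c D hD a b
    simp only [LinearMap.smul_apply, hD a b, smul_add, smul_mul_assoc, mul_smul_comm]
  lie_mem' := by
    intro D E hD hE a b
    simp only [LieRing.of_associative_ring_bracket, LinearMap.sub_apply, Module.End.mul_apply,
      hD _ _, hE _ _, map_add, sub_mul, mul_sub]
    abel

/-- The Lie ideal of inner derivations `x ↦ b x - x b`, `b ∈ B`. -/
def algInnerDer : LieIdeal 𝕜 (algDer 𝕜 B) where
  carrier := {D | ∃ b : B, ∀ x, D.1 x = b * x - x * b}
  zero_mem' := ⟨0, by simp⟩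
  add_mem' := by
    rintro D E ⟨b, hb⟩ ⟨c, hc⟩
    refine ⟨b + c, fun x => ?_⟩
    change D.1 x + E.1 x = _
    rw [hb, hc, add_mul, mul_add]
    abel
  smul_mem' := by
    rintro c D ⟨b, hb⟩
    refine ⟨c • b, fun x => ?_⟩
    change c • D.1 x = _
    rw [hb, smul_sub, smul_mul_assoc, mul_smul_comm]
  lie_mem := by
    rintro E D ⟨b, hb⟩
    refine ⟨E.1 b, fun x => ?_⟩
    change E.1 (D.1 x) - D.1 (E.1 x) = _
    rw [hb, hb, map_sub, E.2 b x, E.2 x b]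
    abel

/-- The first Hochschild cohomology of a possibly nonunital associative algebra: derivations
modulo inner derivations. -/
abbrev HH1 : Type v := algDer 𝕜 B ⧸ algInnerDer 𝕜 B

end NonUnital

namespace SymmOperad

variable {𝕜 : Type u} [CommRing 𝕜] (P : SymmOperad.{u, v} 𝕜)

/-! ## Derivations of an operad -/

/-- The Lie algebra `Der(P)` (under the commutator) of derivations of an operad: families of linear
maps commuting with the symmetric group actions and satisfying the Leibniz rule for
partial compositions. -/
def Der : LieSubalgebra 𝕜 (∀ n, Module.End 𝕜 (P.obj n)) where
  carrier := {D | (∀ (n : ℕ) (σ : Equiv.Perm (Fin n)) (θ : P.obj n),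
      D n (P.act σ θ) = P.act σ (D n θ)) ∧
    ∀ (m n r : ℕ) (i : Fin m) (h : r + 1 = m + n) (μ : P.obj m) (ν : P.obj n),
      D r (P.comp i h μ ν) = P.comp i h (D m μ) ν + P.comp i h μ (D n ν)}
  zero_mem' := by
    refine ⟨fun n σ θ => ?_, fun m n r i h μ ν => ?_⟩ <;> simp
  add_mem' := by
    rintro D E ⟨hD, hD'⟩ ⟨hE, hE'⟩
    refine ⟨fun n σ θ => ?_, fun m n r i h μ ν => ?_⟩
    · simp only [Pi.add_apply, LinearMap.add_apply, hD, hE, map_add]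
    · simp only [Pi.add_apply, LinearMap.add_apply, hD', hE', map_add]
      abel
  smul_mem' := by
    rintro c D ⟨hD, hD'⟩
    refine ⟨fun n σ θ => ?_, fun m n r i h μ ν => ?_⟩
    · simp only [Pi.smul_apply, LinearMap.smul_apply, hD, map_smul]
    · simp only [Pi.smul_apply, LinearMap.smul_apply, hD', map_smul, smul_add]
  lie_mem' := by
    rintro D E ⟨hD, hD'⟩ ⟨hE, hE'⟩
    refine ⟨fun n σ θ => ?_, fun m n r i h μ ν => ?_⟩
    · simp only [LieRing.of_associative_ring_bracket, Pi.sub_apply, Pi.mul_apply,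
        LinearMap.sub_apply, Module.End.mul_apply, hD, hE, map_sub]
    · simp only [LieRing.of_associative_ring_bracket, Pi.sub_apply, Pi.mul_apply,
        LinearMap.sub_apply, Module.End.mul_apply, hD', hE', map_sub, map_add]
      abel

/-- The value `ad_λ(θ) = λ ∘₁ θ - ∑ᵢ θ ∘ᵢ λ`, for `λ ∈ P(1)` and `θ ∈ P(n)`. -/
def adFun (lam : P.obj 1) {n : ℕ} (θ : P.obj n) : P.obj n :=
  P.comp 0 (Nat.add_comm n 1) lam θ - ∑ i : Fin n, P.comp i rfl θ lam

/-- The Lie ideal `IDer(P)` of inner derivations: those of the form `ad_λ`, `λ ∈ P(1)`. -/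
def innerDer : LieIdeal 𝕜 P.Der where
  carrier := {D | ∃ lam : P.obj 1, ∀ (n : ℕ) (θ : P.obj n), D.1 n θ = P.adFun lam θ}
  zero_mem' := ⟨0, fun n θ => by simp [adFun]⟩
  add_mem' := by
    rintro D E ⟨b, hb⟩ ⟨c, hc⟩
    refine ⟨b + c, fun n θ => ?_⟩
    change D.1 n θ + E.1 n θ = _
    rw [hb, hc]
    simp only [adFun, map_add, LinearMap.add_apply, Finset.sum_add_distrib]
    abel
  smul_mem' := by
    rintro c D ⟨b, hb⟩
    refine ⟨c • b, fun n θ => ?_⟩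
    change c • D.1 n θ = _
    rw [hb]
    simp only [adFun, map_smul, LinearMap.smul_apply, smul_sub, Finset.smul_sum]
  lie_mem := by
    rintro E D ⟨b, hb⟩
    refine ⟨E.1 1 b, fun n θ => ?_⟩
    change E.1 n (D.1 n θ) - D.1 n (E.1 n θ) = _
    rw [hb, hb]
    simp only [adFun, map_sub, map_sum, E.2.2, Finset.sum_add_distrib]
    abel

/-- The first cohomology group `H¹(P) = Der(P) / IDer(P)`, with its quotient Lie algebra
structure. -/
abbrev H1 : Type v := P.Der ⧸ P.innerDer

/-! ## Unitary and 2-unitary operads, the algebra `P(1)` and its augmentation ideal -/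

/-- `u₀` is a `0`-unit: `P(0)` is free of rank one on `u₀`. -/
def IsZeroUnit (u₀ : P.obj 0) : Prop :=
  Function.Bijective (fun c : 𝕜 => c • u₀)

/-- `u₂` is a `2`-unit relative to `u₀`: `u₂ ∘₁ u₀ = 𝟙 = u₂ ∘₂ u₀`. -/
def IsTwoUnit (u₀ : P.obj 0) (u₂ : P.obj 2) : Prop :=
  P.comp (0 : Fin 2) (by omega) u₂ u₀ = P.one ∧ P.comp (1 : Fin 2) (by omega) u₂ u₀ = P.one

/-- `P` is `2`-unitary: it is unitary, with a `0`-unit that admits a `2`-unit. -/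
def IsTwoUnitary : Prop :=
  ∃ u₀ : P.obj 0, P.IsZeroUnit u₀ ∧ ∃ u₂ : P.obj 2, P.IsTwoUnit u₀ u₂

/-- `P(1)` is an associative algebra under `∘₁`, with unit `𝟙`. -/
instance ringOne : Ring (P.obj 1) :=
  { P.addCommGroup 1 with
    mul := fun a b => P.comp (0 : Fin 1) rfl a b
    one := P.one
    left_distrib := fun a b c => (P.comp (0 : Fin 1) rfl a).map_add b c
    right_distrib := fun a b c => by
      change P.comp (0 : Fin 1) rfl (a + b) c = _
      rw [map_add]; rfl
    zero_mul := fun a => by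
      change P.comp (0 : Fin 1) rfl 0 a = 0
      simp
    mul_zero := fun a => (P.comp (0 : Fin 1) rfl a).map_zero
    mul_assoc := fun a b c => P.comp_assoc 0 0 0 rfl rfl rfl rfl rfl a b c
    one_mul := fun a => P.one_comp a
    mul_one := fun a => P.comp_one 0 a }

instance algebraOne : Algebra 𝕜 (P.obj 1) :=
  Algebra.ofModule
    (fun c a b => by
      change P.comp (0 : Fin 1) rfl (c • a) b = c • P.comp (0 : Fin 1) rfl a b
      simp)
    (fun c a b => by
      change P.comp (0 : Fin 1) rfl a (c • b) = c • P.comp (0 : Fin 1) rfl a b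
      simp)

/-- The augmentation ideal of `P(1)`, as a nonunital algebra: the elements `a` that act as `0` on
`P(0)` by `x ↦ a ∘₁ x`.  If `P(0)` is free on a `0`-unit `u₀`, then `a ∘₁ u₀ = ε(a) u₀` defines
the augmentation `ε : P(1) → 𝕜`, and this is the kernel of `ε`. -/
def augIdeal : NonUnitalSubalgebra 𝕜 (P.obj 1) where
  carrier := {a | ∀ x : P.obj 0, P.comp (0 : Fin 1) (Nat.add_comm 0 1) a x = (0 : P.obj 0)}
  zero_mem' := by intro x; simp
  add_mem' := by
    intro a b ha hb x
    simp only [map_add, LinearMap.add_apply, ha x, hb x, add_zero]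
  smul_mem' := by
    intro c a ha x
    simp only [map_smul, LinearMap.smul_apply, ha x, smul_zero]
  mul_mem' := by
    intro a b ha hb x
    have := P.comp_assoc (0 : Fin 1) (0 : Fin 1) (0 : Fin 1)
      (rfl : 1 + 1 = 1 + 1) (Nat.add_comm 0 1) (Nat.add_comm 0 1) (Nat.add_comm 0 1)
      rfl a b x
    rw [hb x, map_zero] at this
    exact this

/-! ## One-sided and two-sided ideals, chain conditions, semiprimeness -/

/-- A family of `𝕜 Sₙ`-submodules `I(n) ⊆ P(n)` with `μ ∘ᵢ x ∈ I` for `μ ∈ P`, `x ∈ I`. -/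
def IsLeftIdeal (I : ∀ n, Submodule 𝕜 (P.obj n)) : Prop :=
  (∀ (n : ℕ) (σ : Equiv.Perm (Fin n)), ∀ x ∈ I n, P.act σ x ∈ I n) ∧
  ∀ (m n r : ℕ) (i : Fin m) (h : r + 1 = m + n) (μ : P.obj m), ∀ x ∈ I n, P.comp i h μ x ∈ I r

/-- A family of `𝕜 Sₙ`-submodules `I(n) ⊆ P(n)` with `x ∘ᵢ ν ∈ I` for `x ∈ I`, `ν ∈ P`. -/
def IsRightIdeal (I : ∀ n, Submodule 𝕜 (P.obj n)) : Prop :=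
  (∀ (n : ℕ) (σ : Equiv.Perm (Fin n)), ∀ x ∈ I n, P.act σ x ∈ I n) ∧
  ∀ (m n r : ℕ) (i : Fin m) (h : r + 1 = m + n), ∀ x ∈ I m, ∀ ν : P.obj n, P.comp i h x ν ∈ I r

/-- An operadic (two-sided) ideal. -/
def IsIdeal (I : ∀ n, Submodule 𝕜 (P.obj n)) : Prop :=
  P.IsLeftIdeal I ∧ P.IsRightIdeal I

/-- Every descending chain of left ideals stabilizes. -/
def IsLeftArtinian : Prop :=
  ∀ I : ℕ → ∀ n, Submodule 𝕜 (P.obj n), (∀ t, P.IsLeftIdeal (I t)) → Antitone I →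
    ∃ N, ∀ t, N ≤ t → I t = I N

/-- Every descending chain of right ideals stabilizes. -/
def IsRightArtinian : Prop :=
  ∀ I : ℕ → ∀ n, Submodule 𝕜 (P.obj n), (∀ t, P.IsRightIdeal (I t)) → Antitone I →
    ∃ N, ∀ t, N ≤ t → I t = I N

/-- `P` is semiprime: an ideal `I` with `I² = 0`, that is, `x ∘ᵢ y = 0` for all `x, y ∈ I`
and all `i`, is zero. -/
def IsSemiprime : Prop :=
  ∀ I : ∀ n, Submodule 𝕜 (P.obj n), P.IsIdeal I →
    (∀ (m n r : ℕ) (i : Fin m) (h : r + 1 = m + n), ∀ x ∈ I m, ∀ y ∈ I n, P.comp i h x y = 0) →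
    ∀ n, I n = ⊥

end SymmOperad

/-! Composing with the 0-unit `u₀` erases an input. The elements whose erasures down to arities
below `k` all vanish form a truncation ideal `trunc k`, which is zero in arities `n < k`. The chain
of these ideals stabilizes by the artinian condition, and its stable value is zero because a fixed
arity dies far along the chain. Since `trunc a ∘ trunc b ⊆ trunc (a + b - 1)`, for `k ≥ 2` the
square of `trunc k` lies in `trunc (k + 1)`, so semiprimeness brings the vanishing down to `trunc 2
= 0` (`trunc_two_eq_bot`). It stops there: `trunc 1` is `Ā` in arity one.

Hence an element of arity at least two is determined by its erasures. A derivation is then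
determined by its values on `u₀` and on `Ā`, as `P(1) = 𝕜 𝟙 ⊕ Ā` and `𝟙` is killed
(`derivation_eq_zero`); the value on `u₀` is a scalar, accounted for by a grading derivation.
Conversely, the 2-unit pads elements by extra inputs, which extends a derivation of `Ā` to maps
commuting with erasures (`erase_extend`); equivariance and the Leibniz rule can then be tested on
erasures (`mem_Der_of_erase`).

Commutators of derivations vanish on `P(0)`, so the sequence splits as a direct product. Grading
derivations are inner, and `ad_b` for `b ∈ Ā` also commutes with erasures, so inner derivations
correspond on both sides. -/

namespace SymmOperad

/-! ### Erasing inputs with the 0-unit. -/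

section Erase

variable {𝕜 : Type u} [CommRing 𝕜] (P : SymmOperad.{u, v} 𝕜) (u₀ : P.obj 0)

/-- Insertion of `u₀` in the `j`-th input. -/
def erase {n : ℕ} (j : Fin (n + 1)) : P.obj (n + 1) →ₗ[𝕜] P.obj n :=
  (P.comp j (rfl : n + 1 = n + 1 + 0)).flip u₀

theorem erase_comp_inner {m n r : ℕ} (i : Fin m) (j : Fin (n + 1)) (p : Fin (r + 1))
    (h : r + 1 + 1 = m + (n + 1)) (h' : r + 1 = m + n) (hp : (p : ℕ) = i + j)
    (μ : P.obj m) (ν : P.obj (n + 1)) :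
    P.erase u₀ p (P.comp i h μ ν) = P.comp i h' μ (P.erase u₀ j ν) :=
  P.comp_assoc (n := 0) (s := n) (t := r) i j p h rfl rfl h' hp μ ν u₀

/-- The alternatives in `hp` place the erased input `k` after or before the slot `i`; they are the
two directions of the parallel axiom `comp_comm`. -/
theorem erase_comp_outer {m n r : ℕ} (i k : Fin (m + 1)) (i' : Fin m) (p : Fin (r + 1))
    (h : r + 1 + 1 = m + 1 + n) (h' : r + 1 = m + n)
    (hp : ((i : ℕ) < k ∧ (p : ℕ) + 1 = k + n ∧ (i' : ℕ) = i) ∨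
      ((k : ℕ) < i ∧ (p : ℕ) = k ∧ (i' : ℕ) + 1 = i))
    (μ : P.obj (m + 1)) (ν : P.obj n) :
    P.erase u₀ p (P.comp i h μ ν) = P.comp i' h' (P.erase u₀ k μ) ν := by
  rcases hp with ⟨h1, h2, h3⟩ | ⟨h1, h2, h3⟩
  · exact P.comp_comm (m := n) (n := 0) (s := m) (t := r) i k p i' h rfl rfl h' h1 h2 h3 μ ν u₀
  · exact (P.comp_comm (m := 0) (n := n) (r := m) (t := r) k i i' p rfl h' h rfl h1 h3 h2 μ u₀ ν).symm

/-- An input of `μ ∘ᵢ ν` comes either from `ν` or from `μ`. -/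
theorem input_cases {m n r : ℕ} (i : Fin m) (h : r + 1 + 1 = m + n) (p : Fin (r + 1)) :
    (∃ (n' : ℕ) (j : Fin (n' + 1)), n = n' + 1 ∧ r + 1 = m + n' ∧ (p : ℕ) = i + j) ∨
    (∃ (m' : ℕ) (k : Fin (m' + 1)) (i' : Fin m'), m = m' + 1 ∧ r + 1 = m' + n ∧
      (((i : ℕ) < k ∧ (p : ℕ) + 1 = k + n ∧ (i' : ℕ) = i) ∨
      ((k : ℕ) < i ∧ (p : ℕ) = k ∧ (i' : ℕ) + 1 = i))) := by
  have hi := i.2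
  have hp := p.2
  rcases lt_or_ge (p : ℕ) i with h1 | h1
  · exact Or.inr ⟨m - 1, ⟨p, by omega⟩, ⟨i - 1, by omega⟩, by omega, by omega,
      Or.inr ⟨h1, rfl, by simp only; omega⟩⟩
  rcases lt_or_ge (p : ℕ) (i + n) with h2 | h2
  · exact Or.inl ⟨n - 1, ⟨p - i, by omega⟩, by omega, by omega, by simp only; omega⟩
  · exact Or.inr ⟨m - 1, ⟨p + 1 - n, by omega⟩, ⟨i, by omega⟩, by omega, by omega,
      Or.inl ⟨by simp only; omega, by simp only; omega, rfl⟩⟩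

/-- The permutation `τ` is `permOuter` with an empty block. Later inductions only need that it does
not depend on `θ`. -/
theorem erase_act {n : ℕ} (j : Fin (n + 1)) (σ : Equiv.Perm (Fin (n + 1))) :
    ∃ τ : Equiv.Perm (Fin n), ∀ θ : P.obj (n + 1),
      P.erase u₀ j (P.act σ θ) = P.act τ (P.erase u₀ (σ j) θ) :=
  ⟨_, fun θ => P.act_comp (n := 0) (r := n) j rfl σ θ u₀⟩

theorem erase_erase {n : ℕ} (i k : Fin (n + 2)) (i' k' : Fin (n + 1)) (hik : i < k)
    (hi : (i' : ℕ) = i) (hk : (k' : ℕ) + 1 = k) (θ : P.obj (n + 2)) :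
    P.erase u₀ k' (P.erase u₀ i θ) = P.erase u₀ i' (P.erase u₀ k θ) :=
  P.comp_comm (m := 0) (n := 0) (r := n + 1) (s := n + 1) (t := n) i k k' i' rfl rfl rfl rfl hik hk hi θ u₀ u₀

/-! ## Truncation ideals -/

/-- The `k`-th truncation ideal: the elements all of whose restrictions to fewer than `k` inputs
vanish. -/
def trunc (k : ℕ) : ∀ n, Submodule 𝕜 (P.obj n)
  | 0 => if 0 < k then ⊥ else ⊤
  | n + 1 => if n + 1 < k then ⊥ else ⨅ j, (trunc k n).comap (P.erase u₀ j)

theorem trunc_of_lt {k n : ℕ} (h : n < k) : P.trunc u₀ k n = ⊥ := by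
  cases n <;> simp [trunc, h]

variable {P u₀}

theorem eq_zero_of_mem_trunc {k n : ℕ} (h : n < k) {x : P.obj n} (hx : x ∈ P.trunc u₀ k n) :
    x = 0 := by
  rwa [trunc_of_lt P u₀ h] at hx

theorem mem_trunc_succ {k n : ℕ} (h : k ≤ n + 1) {x : P.obj (n + 1)} :
    x ∈ P.trunc u₀ k (n + 1) ↔ ∀ j, P.erase u₀ j x ∈ P.trunc u₀ k n := by
  simp [trunc, Nat.not_lt.2 h]

theorem erase_mem_trunc {k n : ℕ} {x : P.obj (n + 1)} (hx : x ∈ P.trunc u₀ k (n + 1))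
    (j : Fin (n + 1)) : P.erase u₀ j x ∈ P.trunc u₀ k n := by
  rcases lt_or_ge (n + 1) k with h | h
  · rw [eq_zero_of_mem_trunc h hx, map_zero]
    exact zero_mem _
  · exact (mem_trunc_succ h).1 hx j

theorem trunc_succ_le (k n : ℕ) : P.trunc u₀ (k + 1) n ≤ P.trunc u₀ k n := by
  induction n with
  | zero => rw [trunc_of_lt P u₀ (Nat.succ_pos k)]; exact bot_le
  | succ n ih =>
    intro x hx
    rcases lt_or_ge (n + 1) (k + 1) with h | h
    · rw [eq_zero_of_mem_trunc h hx]
      exact zero_mem _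
    · rw [mem_trunc_succ (by omega)]
      exact fun j => ih (erase_mem_trunc hx j)

theorem act_mem_trunc {k n : ℕ} (σ : Equiv.Perm (Fin n)) {x : P.obj n}
    (hx : x ∈ P.trunc u₀ k n) : P.act σ x ∈ P.trunc u₀ k n := by
  induction n with
  | zero => rwa [Subsingleton.elim σ 1, P.act_one]
  | succ n ih =>
    rcases lt_or_ge (n + 1) k with h | h
    · rw [eq_zero_of_mem_trunc h hx, map_zero]
      exact zero_mem _
    · rw [mem_trunc_succ h]
      intro j
      obtain ⟨τ, hτ⟩ := P.erase_act u₀ j σ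
      rw [hτ]
      exact ih τ (erase_mem_trunc hx _)

theorem comp_mem_trunc_left {k m n r : ℕ} (hk : 0 < k) (i : Fin m) (h : r + 1 = m + n)
    (μ : P.obj m) {x : P.obj n} (hx : x ∈ P.trunc u₀ k n) :
    P.comp i h μ x ∈ P.trunc u₀ k r := by
  induction r generalizing m n with
  | zero =>
    have := i.2
    rw [eq_zero_of_mem_trunc (by omega) hx, map_zero]
    exact zero_mem _
  | succ r ih =>
    rcases lt_or_ge n k with hn | hn
    · rw [eq_zero_of_mem_trunc hn hx, map_zero]
      exact zero_mem _
    have hi := i.2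
    rw [mem_trunc_succ (by omega)]
    intro p
    rcases input_cases i h p with ⟨n', j, rfl, h', hp⟩ | ⟨m', l, i', rfl, h', hp⟩
    · rw [P.erase_comp_inner u₀ i j p h h' hp]
      exact ih i h' μ (erase_mem_trunc hx j)
    · rw [P.erase_comp_outer u₀ i l i' p h h' hp]
      exact ih i' h' _ hx

theorem comp_zero_mem_trunc (h0 : P.IsZeroUnit u₀) {k m r : ℕ} (i : Fin m) (h : r + 1 = m + 0)
    {x : P.obj m} (hx : x ∈ P.trunc u₀ k m) (ν : P.obj 0) :
    P.comp i h x ν ∈ P.trunc u₀ k r := by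
  obtain ⟨c, rfl⟩ := h0.2 ν
  obtain rfl : m = r + 1 := by omega
  simp only [map_smul]
  exact Submodule.smul_mem _ _ (erase_mem_trunc hx i)

theorem comp_mem_trunc_right (h0 : P.IsZeroUnit u₀) {k m n r : ℕ} (i : Fin m)
    (h : r + 1 = m + n) {x : P.obj m} (hx : x ∈ P.trunc u₀ k m) (ν : P.obj n) :
    P.comp i h x ν ∈ P.trunc u₀ k r := by
  have hi := i.2
  induction r generalizing m n with
  | zero =>
    obtain rfl : n = 0 := by omega
    exact comp_zero_mem_trunc h0 i h hx ν
  | succ r ih =>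
    rcases Nat.eq_zero_or_pos n with rfl | hn
    · exact comp_zero_mem_trunc h0 i h hx ν
    rcases lt_or_ge m k with hm | hm
    · rw [eq_zero_of_mem_trunc hm hx, map_zero]
      exact zero_mem _
    rw [mem_trunc_succ (by omega)]
    intro p
    rcases input_cases i h p with ⟨n', j, rfl, h', hp⟩ | ⟨m', l, i', rfl, h', hp⟩
    · rw [P.erase_comp_inner u₀ i j p h h' hp]
      exact ih i h' hx _ hi
    · rw [P.erase_comp_outer u₀ i l i' p h h' hp]
      exact ih i' h' (erase_mem_trunc hx l) _ i'.2

theorem isIdeal_trunc (h0 : P.IsZeroUnit u₀) {k : ℕ} (hk : 0 < k) : P.IsIdeal (P.trunc u₀ k) :=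
  ⟨⟨fun _ σ _ hx => act_mem_trunc σ hx,
    fun _ _ _ i h μ _ hx => comp_mem_trunc_left hk i h μ hx⟩,
   ⟨fun _ σ _ hx => act_mem_trunc σ hx,
    fun _ _ _ i h _ hx ν => comp_mem_trunc_right h0 i h hx ν⟩⟩

/-- Each erasure of `x ∘ᵢ y` erases an input of one factor. A nonzero composite needs `m ≥ a` and `n
≥ b`, hence arity at least `a + b - 1`. -/
theorem comp_mem_trunc_add {a b m n r : ℕ} (i : Fin m) (h : r + 1 = m + n)
    {x : P.obj m} (hx : x ∈ P.trunc u₀ a m) {y : P.obj n} (hy : y ∈ P.trunc u₀ b n) :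
    P.comp i h x y ∈ P.trunc u₀ (a + b - 1) r := by
  rcases lt_or_ge m a with hm | hm
  · rw [eq_zero_of_mem_trunc hm hx, map_zero]
    exact zero_mem _
  rcases lt_or_ge n b with hn | hn
  · rw [eq_zero_of_mem_trunc hn hy, map_zero]
    exact zero_mem _
  induction r generalizing m n with
  | zero =>
    -- Here `m = 1` and `n = 0`, so `a ≤ 1`, `b = 0` and the truncated difference `a + b - 1` is
    -- `0`.
    have : P.trunc u₀ (a + b - 1) 0 = ⊤ := by
      simp [trunc]
      omega
    rw [this]
    trivial
  | succ r ih =>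
    rw [mem_trunc_succ (by omega)]
    intro p
    -- The induction hypothesis freed of its arity bounds: an erasure may push a factor below its
    -- bound, where that factor is zero.
    have key : ∀ {m n : ℕ} (i : Fin m) (h : r + 1 = m + n) {x : P.obj m}
        (_ : x ∈ P.trunc u₀ a m) {y : P.obj n} (_ : y ∈ P.trunc u₀ b n),
        P.comp i h x y ∈ P.trunc u₀ (a + b - 1) r := by
      intro m n i h x hx y hy
      rcases lt_or_ge m a with hm | hm
      · rw [eq_zero_of_mem_trunc hm hx, map_zero]
        exact zero_mem _
      rcases lt_or_ge n b with hn | hn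
      · rw [eq_zero_of_mem_trunc hn hy, map_zero]
        exact zero_mem _
      exact ih i h hx hy hm hn
    rcases input_cases i h p with ⟨n', j, rfl, h', hp⟩ | ⟨m', l, i', rfl, h', hp⟩
    · rw [P.erase_comp_inner u₀ i j p h h' hp]
      exact key i h' hx (erase_mem_trunc hy j)
    · rw [P.erase_comp_outer u₀ i l i' p h h' hp]
      exact key i' h' (erase_mem_trunc hx l) hy

theorem exists_trunc_eq_bot (h0 : P.IsZeroUnit u₀)
    (hart : P.IsLeftArtinian ∨ P.IsRightArtinian) :
    ∃ k, ∀ n, P.trunc u₀ k n = ⊥ := by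
  have hanti : Antitone fun t => P.trunc u₀ (t + 1) :=
    antitone_nat_of_succ_le fun t n => trunc_succ_le (t + 1) n
  obtain ⟨N, hN⟩ : ∃ N, ∀ t, N ≤ t → P.trunc u₀ (t + 1) = P.trunc u₀ (N + 1) := by
    rcases hart with h | h
    · exact h _ (fun t => (isIdeal_trunc h0 t.succ_pos).1) hanti
    · exact h _ (fun t => (isIdeal_trunc h0 t.succ_pos).2) hanti
  refine ⟨N + 1, fun n => ?_⟩
  -- In arity `n` the stable value can be read off at index `N + n + 1 > n`.
  rw [← hN (N + n) (by omega)]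
  exact trunc_of_lt P u₀ (by omega)

/-- If `trunc (j + 3) = 0`, then `trunc (j + 2)` has square inside `trunc (2 j + 3)`, which is zero
because `2 j + 3 ≥ j + 3`; semiprimeness then kills `trunc (j + 2)`. -/
theorem trunc_two_eq_bot (h0 : P.IsZeroUnit u₀)
    (hart : P.IsLeftArtinian ∨ P.IsRightArtinian) (hsemi : P.IsSemiprime) (n : ℕ) :
    P.trunc u₀ 2 n = ⊥ := by
  obtain ⟨k, hk⟩ := exists_trunc_eq_bot h0 hart
  have step : ∀ j, (∀ n, P.trunc u₀ (j + 2) n = ⊥) → ∀ n, P.trunc u₀ 2 n = ⊥ := by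
    intro j
    induction j with
    | zero => exact id
    | succ j ih =>
      intro hj
      refine ih (hsemi _ (isIdeal_trunc h0 (by omega)) fun m n r i h x hx y hy => ?_)
      have : ∀ d, ∀ n, P.trunc u₀ (j + 1 + 2 + d) n = ⊥ := by
        intro d
        induction d with
        | zero => exact hj
        | succ d ihd => exact fun n => eq_bot_iff.2 ((trunc_succ_le _ n).trans (ihd n).le)
      have hxy := comp_mem_trunc_add i h hx hy
      rw [show j + 2 + (j + 2) - 1 = j + 1 + 2 + j by omega, this] at hxy
      exact hxy
  refine step k (fun n => eq_bot_iff.2 ?_) n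
  exact (trunc_succ_le _ n).trans ((trunc_succ_le _ n).trans (hk n).le)

/-- Elements of arity at least `2` are determined by their erasures. -/
theorem eq_zero_of_erase_eq_zero (hT : ∀ n, P.trunc u₀ 2 n = ⊥) {n : ℕ} {x : P.obj (n + 2)}
    (hx : ∀ j, P.erase u₀ j x = 0) : x = 0 := by
  have : x ∈ P.trunc u₀ 2 (n + 2) := by
    rw [mem_trunc_succ (by omega)]
    intro j
    rw [hx]
    exact zero_mem _
  rwa [hT] at this

end Erase

/-! ### Restriction to `Ā`, grading derivations and the splitting of `P(1)`. -/

section Derivations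

variable {𝕜 : Type u} [CommRing 𝕜] (P : SymmOperad.{u, v} 𝕜)

theorem one_mul_eq_comp (a b : P.obj 1) : a * b = P.comp (0 : Fin 1) rfl a b := rfl

theorem derivation_one (D : P.Der) : D.1 1 P.one = 0 := by
  have h := D.2.2 1 1 1 0 rfl P.one P.one
  rw [P.comp_one, P.comp_one, ← one_mul_eq_comp] at h
  have h1 : P.one * D.1 1 P.one = D.1 1 P.one := one_mul _
  rw [h1] at h
  simpa using h

theorem derivation_mem_augIdeal (D : P.Der) {a : P.obj 1} (ha : a ∈ P.augIdeal) :
    D.1 1 a ∈ P.augIdeal := by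
  intro x
  have h := D.2.2 1 0 0 0 (Nat.add_comm 0 1) a x
  rw [ha x, map_zero, ha (D.1 0 x), add_zero] at h
  exact h.symm

/-- Restriction of operadic derivations to the augmentation ideal. -/
def derRestrict : P.Der →ₗ⁅𝕜⁆ algDer 𝕜 P.augIdeal where
  toFun D :=
    ⟨{ toFun := fun a => ⟨D.1 1 a, P.derivation_mem_augIdeal D a.2⟩
       map_add' := fun a b => Subtype.ext ((D.1 1).map_add a b)
       map_smul' := fun c a => Subtype.ext ((D.1 1).map_smul c a) },
     fun a b => Subtype.ext (D.2.2 1 1 1 0 rfl a b)⟩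
  map_add' _ _ := rfl
  map_smul' _ _ := rfl
  map_lie' := rfl

theorem coe_derRestrict_apply (D : P.Der) (a : P.augIdeal) :
    (((P.derRestrict D).1 a : P.augIdeal) : P.obj 1) = D.1 1 a := rfl

/-- The derivation multiplying `P(n)` by `(n - 1) c`. -/
def gradingDer : 𝕜 →ₗ⁅𝕜⁆ P.Der where
  toFun c := ⟨fun n => (((n : 𝕜) - 1) * c) • LinearMap.id, by
    refine ⟨fun n σ θ => by simp, fun m n r i h μ ν => ?_⟩
    -- The Leibniz rule amounts to `r - 1 = (m - 1) + (n - 1)`.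
    have h' : (r : 𝕜) + 1 = m + n := by exact_mod_cast congrArg (Nat.cast (R := 𝕜)) h
    simp only [LinearMap.smul_apply, LinearMap.id_apply, map_smul, ← add_smul]
    congr 1
    linear_combination c * h'⟩
  map_add' a b := by
    apply Subtype.ext
    funext n
    exact (congrArg (· • LinearMap.id) (mul_add _ a b)).trans (add_smul _ _ _)
  map_smul' a b := by
    apply Subtype.ext
    funext n
    change (((n : 𝕜) - 1) * (a * b)) • (LinearMap.id : Module.End 𝕜 (P.obj n)) =
      a • (((n : 𝕜) - 1) * b) • (LinearMap.id : Module.End 𝕜 (P.obj n))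
    rw [smul_smul]
    congr 1
    ring
  map_lie' := by
    intro a b
    apply Subtype.ext
    funext n
    ext θ
    change (((n : 𝕜) - 1) * (a * b - b * a)) • θ =
      (((n : 𝕜) - 1) * a) • (((n : 𝕜) - 1) * b) • θ -
      (((n : 𝕜) - 1) * b) • (((n : 𝕜) - 1) * a) • θ
    rw [smul_smul, smul_smul, ← sub_smul]
    congr 1
    ring

theorem gradingDer_apply (c : 𝕜) (n : ℕ) (θ : P.obj n) :
    (P.gradingDer c).1 n θ = (((n : 𝕜) - 1) * c) • θ := rfl

theorem derRestrict_gradingDer (c : 𝕜) : P.derRestrict (P.gradingDer c) = 0 := by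
  apply Subtype.ext
  ext a
  change ((((1 : ℕ) : 𝕜) - 1) * c) • (a : P.obj 1) = 0
  simp

/-- The element `𝟙` acts once on the output and once on each of the `n` inputs, so `ad_𝟙` is
multiplication by `1 - n`. Thus the kernel of restriction disappears in `H¹`. -/
theorem gradingDer_eq_adFun (c : 𝕜) (n : ℕ) (θ : P.obj n) :
    (P.gradingDer c).1 n θ = P.adFun (-c • P.one) θ := by
  rw [gradingDer_apply]
  simp only [adFun, map_smul, LinearMap.smul_apply, P.one_comp, P.comp_one, Finset.sum_const,
    Finset.card_univ, Fintype.card_fin, ← Nat.cast_smul_eq_nsmul 𝕜, smul_smul, ← sub_smul]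
  congr 1
  ring

variable {P} {u₀ : P.obj 0} (h0 : P.IsZeroUnit u₀)

/-- The coordinate of an element of `P(0)` along a `0`-unit. -/
noncomputable def zeroCoeff : P.obj 0 →ₗ[𝕜] 𝕜 :=
  (LinearEquiv.ofBijective (LinearMap.toSpanSingleton 𝕜 (P.obj 0) u₀) h0).symm.toLinearMap

theorem zeroCoeff_smul (x : P.obj 0) : zeroCoeff h0 x • u₀ = x :=
  (LinearEquiv.ofBijective (LinearMap.toSpanSingleton 𝕜 (P.obj 0) u₀) h0).apply_symm_apply x

theorem zeroCoeff_smul_unit (c : 𝕜) : zeroCoeff h0 (c • u₀) = c :=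
  (LinearEquiv.ofBijective (LinearMap.toSpanSingleton 𝕜 (P.obj 0) u₀) h0).symm_apply_apply c

theorem mem_augIdeal_iff (h0 : P.IsZeroUnit u₀) {a : P.obj 1} : a ∈ P.augIdeal ↔ P.erase u₀ 0 a = 0 := by
  refine ⟨fun h => h u₀, fun h x => ?_⟩
  obtain ⟨c, rfl⟩ := h0.2 x
  have h' : P.comp (0 : Fin 1) (Nat.add_comm 0 1) a u₀ = (0 : P.obj 0) := h
  simp only [map_smul, h', smul_zero]

theorem erase_one : P.erase u₀ 0 P.one = u₀ := P.one_comp u₀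

/-- The augmentation of the algebra `P(1)`. -/
noncomputable def aug : P.obj 1 →ₗ[𝕜] 𝕜 := zeroCoeff h0 ∘ₗ P.erase u₀ 0

theorem erase_eq_aug_smul (a : P.obj 1) : P.erase u₀ 0 a = aug h0 a • u₀ :=
  (zeroCoeff_smul h0 _).symm

theorem aug_one : aug h0 P.one = 1 := by
  have := zeroCoeff_smul_unit h0 1
  rw [one_smul] at this
  rw [aug, LinearMap.comp_apply, erase_one, this]

theorem aug_mul (a b : P.obj 1) : aug h0 (a * b) = aug h0 a * aug h0 b := by
  have : P.erase u₀ 0 (a * b) = (aug h0 a * aug h0 b) • u₀ := by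
    rw [one_mul_eq_comp, P.erase_comp_inner u₀ 0 0 0 rfl rfl rfl, erase_eq_aug_smul h0 b,
      map_smul, mul_comm, mul_smul, ← erase_eq_aug_smul h0 a]
    rfl
  rw [aug, LinearMap.comp_apply, this, zeroCoeff_smul_unit]
  rfl

/-- The projection of `P(1) = 𝕜 𝟙 ⊕ Ā` to the augmentation ideal `Ā`. -/
noncomputable def augProj : P.obj 1 →ₗ[𝕜] P.augIdeal where
  toFun a := ⟨a - aug h0 a • P.one, by
    rw [mem_augIdeal_iff h0, map_sub, map_smul, erase_one, erase_eq_aug_smul h0, sub_self]⟩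
  map_add' a b := Subtype.ext (by simp [add_smul]; abel)
  map_smul' c a := Subtype.ext (by simp [smul_sub, mul_smul])

theorem aug_smul_add_augProj (a : P.obj 1) : aug h0 a • P.one + (augProj h0 a : P.obj 1) = a := by
  change _ + (a - _) = _
  abel

theorem augProj_coe (a : P.augIdeal) : augProj h0 a = a := by
  apply Subtype.ext
  change (a : P.obj 1) - aug h0 a • P.one = a
  have : aug h0 (a : P.obj 1) = 0 := by
    rw [aug, LinearMap.comp_apply, (mem_augIdeal_iff h0).1 a.2, map_zero]
  rw [this, zero_smul, sub_zero]

theorem augProj_one : augProj h0 P.one = 0 := by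
  apply Subtype.ext
  change P.one - aug h0 P.one • P.one = 0
  rw [aug_one, one_smul, sub_self]

theorem augProj_mul (a b : P.obj 1) : augProj h0 (a * b) =
    aug h0 a • augProj h0 b + aug h0 b • augProj h0 a + augProj h0 a * augProj h0 b := by
  apply Subtype.ext
  change a * b - aug h0 (a * b) • (1 : P.obj 1) = aug h0 a • (b - aug h0 b • (1 : P.obj 1)) +
    aug h0 b • (a - aug h0 a • (1 : P.obj 1)) +
    (a - aug h0 a • (1 : P.obj 1)) * (b - aug h0 b • (1 : P.obj 1))
  rw [aug_mul]
  simp only [mul_sub, sub_mul, smul_sub, mul_smul_comm, smul_mul_assoc, mul_one, one_mul, mul_smul,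
    smul_comm (aug h0 b) (aug h0 a)]
  abel

/-- A derivation is determined by its values on `P(0)` and on the augmentation ideal when
elements of higher arity are separated by erasures. -/
theorem derivation_eq_zero (h0 : P.IsZeroUnit u₀) (hT : ∀ n, P.trunc u₀ 2 n = ⊥) (D : P.Der) (hu : D.1 0 u₀ = 0)
    (hD : P.derRestrict D = 0) : D = 0 := by
  have key : ∀ n, ∀ θ : P.obj n, D.1 n θ = 0 := by
    intro n
    induction n with
    | zero =>
      intro θ
      rw [← zeroCoeff_smul h0 θ, map_smul, hu, smul_zero]
    | succ n ih =>
      cases n with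
      | zero =>
        intro θ
        have h := congrArg (fun E => ((E.1 (augProj h0 θ) : P.augIdeal) : P.obj 1)) hD
        have h' : D.1 1 (augProj h0 θ : P.obj 1) = 0 := h
        rw [← aug_smul_add_augProj h0 θ, map_add, map_smul, derivation_one, h', smul_zero,
          add_zero]
      | succ n =>
        intro θ
        refine eq_zero_of_erase_eq_zero hT fun j => ?_
        -- As `D` kills `u₀`, the Leibniz rule for `θ ∘ⱼ u₀` says that `D` commutes with erasure.
        have h := D.2.2 _ _ _ j (rfl : n + 1 + 1 = n + 1 + 1 + 0) θ u₀
        rw [hu, map_zero, add_zero, ih] at h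
        exact h.symm
  apply Subtype.ext
  funext n
  ext θ
  exact key n θ

/-! ## Extension of derivations of the augmentation ideal -/

/-- A family of maps which commutes with erasures and is a derivation in arity `1` is an operadic
derivation when elements of higher arity are separated by erasures. -/
theorem mem_Der_of_erase (h0 : P.IsZeroUnit u₀) (hT : ∀ n, P.trunc u₀ 2 n = ⊥) (D : ∀ n, Module.End 𝕜 (P.obj n))
    (hD0 : D 0 = 0) (hD1 : ∀ a b : P.obj 1, D 1 (a * b) = D 1 a * b + a * D 1 b)
    (hD : ∀ n (j : Fin (n + 1)) (θ : P.obj (n + 1)),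
      P.erase u₀ j (D (n + 1) θ) = D n (P.erase u₀ j θ)) : D ∈ P.Der := by
  -- Composing with an element of arity zero is a multiple of an erasure, so this case of the
  -- Leibniz rule is `hD` together with `D 0 = 0`.
  have hzero : ∀ {m r : ℕ} (i : Fin m) (h : r + 1 = m + 0) (μ : P.obj m) (ν : P.obj 0),
      D r (P.comp i h μ ν) = P.comp i h (D m μ) ν + P.comp i h μ (D 0 ν) := by
    intro m r i h μ ν
    obtain rfl : m = r + 1 := by omega
    rw [← zeroCoeff_smul h0 ν, hD0, LinearMap.zero_apply, map_zero, add_zero, map_smul, map_smul,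
      map_smul]
    exact congrArg _ (hD r i μ).symm
  refine ⟨fun n => ?_, fun m n r => ?_⟩
  · induction n with
    | zero => intro σ θ; rw [Subsingleton.elim σ 1, P.act_one, P.act_one]
    | succ n ih =>
      cases n with
      | zero =>
        intro σ θ
        obtain rfl : σ = 1 := Equiv.ext fun x => Fin.ext (by omega)
        rw [P.act_one, P.act_one]
      | succ n =>
        intro σ θ
        rw [← sub_eq_zero]
        refine eq_zero_of_erase_eq_zero hT fun j => ?_
        obtain ⟨τ, hτ⟩ := P.erase_act u₀ j σ
        rw [map_sub, hτ, hD, hτ, ih, hD, sub_self]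
  · induction r generalizing m n with
    | zero =>
      intro i h μ ν
      have := i.2
      obtain rfl : n = 0 := by omega
      exact hzero i h μ ν
    | succ r ih =>
      intro i h μ ν
      have hi := i.2
      cases r with
      | zero =>
        rcases Nat.eq_zero_or_pos n with rfl | hn
        · exact hzero i h μ ν
        obtain rfl : n = 1 := by omega
        obtain rfl : m = 1 := by omega
        obtain rfl : i = 0 := Subsingleton.elim _ _
        exact hD1 μ ν
      | succ r =>
        rw [← sub_eq_zero]
        -- After erasing input `p`, both sides are the Leibniz expressions of a composite of arity
        -- one less.
        refine eq_zero_of_erase_eq_zero hT fun p => ?_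
        rw [map_sub, map_add, hD, sub_eq_zero]
        rcases input_cases i h p with ⟨n', j, rfl, h', hp⟩ | ⟨m', l, i', rfl, h', hp⟩
        · simp only [P.erase_comp_inner u₀ i j p h h' hp, hD, ih]
        · simp only [P.erase_comp_outer u₀ i l i' p h h' hp, hD, ih]

variable (P) in
/-- Iterated insertion in the last input of `u₂`. -/
def tail (u₂ : P.obj 2) : ∀ n, P.obj 1 →ₗ[𝕜] P.obj (n + 1)
  | 0 => LinearMap.id
  | n + 1 => P.comp (1 : Fin 2) (Nat.add_comm (n + 2) 1 |>.trans (by omega)) u₂ ∘ₗ tail u₂ n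

variable (P u₀) in
/-- Restriction to the last input. -/
def lastInput : ∀ n, P.obj (n + 1) →ₗ[𝕜] P.obj 1
  | 0 => LinearMap.id
  | n + 1 => lastInput n ∘ₗ P.erase u₀ 0

theorem lastInput_erase {n : ℕ} (j : Fin (n + 2)) (hj : (j : ℕ) < n + 1) (θ : P.obj (n + 2)) :
    lastInput P u₀ n (P.erase u₀ j θ) = lastInput P u₀ (n + 1) θ := by
  induction n with
  | zero =>
    obtain rfl : j = 0 := Fin.ext (by simp only [Fin.val_zero]; omega)
    rfl
  | succ n ih =>
    rcases Nat.eq_zero_or_pos (j : ℕ) with h | h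
    · obtain rfl : j = 0 := Fin.ext h
      rfl
    · change lastInput P u₀ n (P.erase u₀ 0 (P.erase u₀ j θ)) =
        lastInput P u₀ (n + 1) (P.erase u₀ 0 θ)
      rw [← ih ⟨j - 1, by omega⟩ (by simp only; omega), P.erase_erase u₀ 0 j 0 ⟨j - 1, by omega⟩
        (Fin.lt_def.2 h) rfl (by simp only; omega)]

variable {u₂ : P.obj 2}

/-- Each input but the last is a first input of some copy of `u₂`; erasing it turns that copy into
`𝟙`. -/
theorem erase_tail {n : ℕ} (j : Fin (n + 2)) (hj : (j : ℕ) < n + 1) (h2 : P.IsTwoUnit u₀ u₂)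
    (a : P.obj 1) : P.erase u₀ j (P.tail u₂ (n + 1) a) = P.tail u₂ n a := by
  rcases Nat.eq_zero_or_pos (j : ℕ) with h | h
  · change P.erase u₀ j (P.comp (1 : Fin 2) _ u₂ (P.tail u₂ n a)) = _
    rw [P.erase_comp_outer (m := 1) u₀ 1 0 0 j _ (by omega)
      (Or.inr ⟨by simp, by simpa using h, by simp⟩)]
    have : P.erase u₀ (0 : Fin 2) u₂ = P.one := h2.1
    rw [this]
    exact P.one_comp _
  · induction n with
    | zero => omega
    | succ n ih =>
      change P.erase u₀ j (P.comp (1 : Fin 2) _ u₂ (P.tail u₂ (n + 1) a)) = _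
      rw [P.erase_comp_inner u₀ 1 ⟨j - 1, by omega⟩ j _ (by omega) (by simp; omega)]
      -- The induction hypothesis covers only positive positions, so position `0` of the inner tail
      -- is treated directly.
      rcases Nat.eq_zero_or_pos ((j : ℕ) - 1) with h' | h'
      · have : P.erase u₀ ⟨(j : ℕ) - 1, by omega⟩ (P.tail u₂ (n + 1) a) = P.tail u₂ n a := by
          change P.erase u₀ _ (P.comp (1 : Fin 2) _ u₂ (P.tail u₂ n a)) = _
          rw [P.erase_comp_outer (m := 1) u₀ 1 0 0 _ _ (by omega)
            (Or.inr ⟨by simp, by simpa using h', by simp⟩)]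
          have : P.erase u₀ (0 : Fin 2) u₂ = P.one := h2.1
          rw [this]
          exact P.one_comp _
        rw [this]
        rfl
      · rw [ih _ (by simp only; omega) h']
        rfl

theorem erase_last_tail (n : ℕ) (j : Fin (n + 1)) (hj : (j : ℕ) = n) (u₂ : P.obj 2) {a : P.obj 1}
    (ha : P.erase u₀ 0 a = 0) : P.erase u₀ j (P.tail u₂ n a) = 0 := by
  induction n with
  | zero =>
    obtain rfl : j = 0 := Fin.ext (by simp only [Fin.val_zero]; omega)
    exact ha
  | succ n ih =>
    change P.erase u₀ j (P.comp (1 : Fin 2) _ u₂ (P.tail u₂ n a)) = _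
    rw [P.erase_comp_inner u₀ 1 ⟨n, by omega⟩ j _ (by omega) (by simp; omega), ih _ rfl, map_zero]

variable (u₂) in
/-- The extension to `P` of a linear map on `P(1)`. -/
def extend (u₀ : P.obj 0) (δ : Module.End 𝕜 (P.obj 1)) : ∀ n, Module.End 𝕜 (P.obj n)
  | 0 => 0
  | 1 => δ
  | n + 2 => P.comp (0 : Fin 2) (Nat.add_comm (n + 2) 1 |>.trans (by omega)) u₂ ∘ₗ
      extend u₀ δ (n + 1) ∘ₗ P.erase u₀ (Fin.last (n + 1)) +
      P.tail u₂ (n + 1) ∘ₗ δ ∘ₗ lastInput P u₀ (n + 1)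

theorem extend_succ_succ (δ : Module.End 𝕜 (P.obj 1)) (n : ℕ) (θ : P.obj (n + 2)) :
    extend u₂ u₀ δ (n + 2) θ = P.comp (0 : Fin 2) (by omega : n + 2 + 1 = 2 + (n + 1)) u₂
      (extend u₂ u₀ δ (n + 1) (P.erase u₀ (Fin.last (n + 1)) θ)) +
      P.tail u₂ (n + 1) (δ (lastInput P u₀ (n + 1) θ)) := rfl

/-- Erasing the last input kills the tail, because `δ` takes values in `Ā`, and strips `u₂` from the
first summand, leaving the previous extension. Erasing any other input passes through both summands
and reproduces the recursive formula one arity lower. -/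
theorem erase_extend (h2 : P.IsTwoUnit u₀ u₂) {δ : Module.End 𝕜 (P.obj 1)}
    (hδ : ∀ a, P.erase u₀ 0 (δ a) = 0) (n : ℕ) (j : Fin (n + 1)) (θ : P.obj (n + 1)) :
    P.erase u₀ j (extend u₂ u₀ δ (n + 1) θ) = extend u₂ u₀ δ n (P.erase u₀ j θ) := by
  induction n with
  | zero =>
    obtain rfl : j = 0 := Fin.ext (by simp only [Fin.val_zero]; omega)
    exact hδ θ
  | succ n ih =>
    rw [extend_succ_succ, map_add]
    rcases (Nat.lt_succ_iff_lt_or_eq.1 j.2) with hj | hj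
    · rw [erase_tail j hj h2, P.erase_comp_inner u₀ 0 ⟨j, hj⟩ j _ (by omega) (by simp), ih,
        ← lastInput_erase j hj]
      -- Landing in arity one, the recursion has reached its base: the first summand is zero, as the
      -- extension vanishes on `P(0)`, and the tail is the identity.
      cases n with
      | zero =>
        obtain rfl : j = 0 := Fin.ext (by simp only [Fin.val_zero]; omega)
        change P.comp _ _ u₂ 0 + _ = _
        exact (congrArg (· + _) (map_zero _)).trans (zero_add _)
      | succ n =>
        rw [extend_succ_succ, P.erase_erase u₀ j (Fin.last (n + 2)) ⟨j, hj⟩ (Fin.last (n + 1))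
          (Fin.lt_def.2 hj) rfl (by simp)]
    · obtain rfl : j = Fin.last (n + 1) := Fin.ext hj
      rw [erase_last_tail (n + 1) _ rfl u₂ (hδ _), add_zero,
        P.erase_comp_outer (m := 1) u₀ 0 1 0 _ _ (by omega)
        (Or.inl ⟨by simp, by simp; omega, by simp⟩)]
      have : P.erase u₀ (1 : Fin 2) u₂ = P.one := h2.2
      rw [this]
      exact P.one_comp _

/-- Every derivation of the augmentation ideal extends to a derivation of the operad that
kills the `0`-unit. -/
theorem exists_derivation_extending (h0 : P.IsZeroUnit u₀) (h2 : P.IsTwoUnit u₀ u₂) (hT : ∀ n, P.trunc u₀ 2 n = ⊥)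
    (δ : algDer 𝕜 P.augIdeal) : ∃ D : P.Der, D.1 0 u₀ = 0 ∧ P.derRestrict D = δ := by
  -- Extension of `δ` by zero on `𝟙`; its values stay in `Ā`, as `erase_extend` requires.
  let δ' : Module.End 𝕜 (P.obj 1) :=
    P.augIdeal.toSubmodule.subtype ∘ₗ δ.1 ∘ₗ augProj h0
  have hδ' : ∀ a, δ' a = (δ.1 (augProj h0 a) : P.augIdeal) := fun _ => rfl
  have hmul : ∀ a b : P.obj 1, δ' (a * b) = δ' a * b + a * δ' b := by
    intro a b
    simp only [hδ']
    rw [augProj_mul, map_add, map_add, map_smul, map_smul, δ.2]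
    conv_rhs => rw [← aug_smul_add_augProj h0 a, ← aug_smul_add_augProj h0 b]
    simp only [map_add, map_smul, augProj_one, augProj_coe, smul_zero, zero_add]
    change aug h0 a • (δ.1 (augProj h0 b) : P.obj 1) + aug h0 b • (δ.1 (augProj h0 a) : P.obj 1) +
      ((δ.1 (augProj h0 a) : P.obj 1) * (augProj h0 b : P.obj 1) +
        (augProj h0 a : P.obj 1) * (δ.1 (augProj h0 b) : P.obj 1)) =
      (δ.1 (augProj h0 a) : P.obj 1) * (aug h0 b • (1 : P.obj 1) + augProj h0 b) +
      (aug h0 a • (1 : P.obj 1) + augProj h0 a) * (δ.1 (augProj h0 b) : P.obj 1)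
    rw [mul_add, add_mul, mul_smul_comm, smul_mul_assoc, mul_one, one_mul]
    abel
  refine ⟨⟨extend u₂ u₀ δ', mem_Der_of_erase h0 hT _ rfl hmul
    (erase_extend h2 fun a => (mem_augIdeal_iff h0).1 (δ.1 (augProj h0 a)).2)⟩, rfl, ?_⟩
  apply Subtype.ext
  ext a
  change ((δ.1 (augProj h0 a) : P.augIdeal) : P.obj 1) = δ.1 a
  rw [augProj_coe]

/-! ## The Lie algebra of derivations -/

/-- The coefficient `c` such that a derivation agrees with `gradingDer c` on `P(0)`. -/
noncomputable def gradingCoeff : P.Der →ₗ[𝕜] 𝕜 where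
  -- The sign comes from `n - 1 = -1` at `n = 0`.
  toFun D := -zeroCoeff h0 (D.1 0 u₀)
  map_add' D E := by
    change -zeroCoeff h0 (D.1 0 u₀ + E.1 0 u₀) = _
    rw [map_add, neg_add]
  map_smul' c D := by
    change -zeroCoeff h0 (c • D.1 0 u₀) = _
    rw [map_smul, smul_neg, RingHom.id_apply]

theorem derivation_zero_apply (D : P.Der) (x : P.obj 0) :
    D.1 0 x = -gradingCoeff h0 D • x := by
  rw [← zeroCoeff_smul h0 x, map_smul, smul_comm]
  congr 1
  change _ = -(-zeroCoeff h0 (D.1 0 u₀)) • u₀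
  rw [neg_neg, zeroCoeff_smul]

theorem gradingCoeff_gradingDer (c : 𝕜) : gradingCoeff h0 (P.gradingDer c) = c := by
  change -zeroCoeff h0 (((((0 : ℕ) : 𝕜) - 1) * c) • u₀) = c
  rw [zeroCoeff_smul_unit]
  simp

/-- Derivations act on the rank-one module `P(0)` by scalars, which commute. This makes
`gradingCoeff` a Lie homomorphism to the abelian algebra `𝕜`. -/
theorem gradingCoeff_lie (D E : P.Der) : gradingCoeff h0 ⁅D, E⁆ = 0 := by
  change -zeroCoeff h0 (D.1 0 (E.1 0 u₀) - E.1 0 (D.1 0 u₀)) = 0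
  rw [derivation_zero_apply h0 E u₀, derivation_zero_apply h0 D u₀, map_smul, map_smul,
    derivation_zero_apply h0 E u₀, derivation_zero_apply h0 D u₀, smul_comm, sub_self, map_zero,
    neg_zero]

theorem derivation_eq_gradingDer (hT : ∀ n, P.trunc u₀ 2 n = ⊥) (D : P.Der)
    (hD : P.derRestrict D = 0) : D = P.gradingDer (gradingCoeff h0 D) := by
  rw [← sub_eq_zero]
  apply derivation_eq_zero h0 hT
  · change D.1 0 u₀ - (P.gradingDer (gradingCoeff h0 D)).1 0 u₀ = 0
    rw [derivation_zero_apply h0, derivation_zero_apply h0 (P.gradingDer _),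
      gradingCoeff_gradingDer, sub_self]
  · rw [map_sub, hD, derRestrict_gradingDer, sub_self]

/-- `Der(P)` is the direct product of the derivations in degree zero and of `Der(Ā)`, as a
semidirect sum with trivial action. -/
noncomputable def derToSemiDirectSum :
    P.Der →ₗ⁅𝕜⁆ LieAlgebra.SemiDirectSum 𝕜 (algDer 𝕜 P.augIdeal)
      (0 : algDer 𝕜 P.augIdeal →ₗ⁅𝕜⁆ LieDerivation 𝕜 𝕜 𝕜) where
  toFun D := ⟨gradingCoeff h0 D, P.derRestrict D⟩
  map_add' D E := by simp
  map_smul' c D := by simp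
  map_lie' := by
    intro D E
    have h : ⁅gradingCoeff h0 D, gradingCoeff h0 E⁆ = 0 := by
      rw [LieRing.of_associative_ring_bracket, mul_comm, sub_self]
    simp [gradingCoeff_lie, h]

theorem derToSemiDirectSum_bijective (h2 : P.IsTwoUnit u₀ u₂) (hT : ∀ n, P.trunc u₀ 2 n = ⊥) :
    Function.Bijective (derToSemiDirectSum h0) := by
  constructor
  · rw [injective_iff_map_eq_zero]
    intro D hD
    have h1 : gradingCoeff h0 D = 0 := congrArg LieAlgebra.SemiDirectSum.left hD
    have h2 : P.derRestrict D = 0 := congrArg LieAlgebra.SemiDirectSum.right hD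
    rw [derivation_eq_gradingDer h0 hT D h2, h1, map_zero]
  · rintro ⟨c, δ⟩
    obtain ⟨D, hu, rfl⟩ := exists_derivation_extending h0 h2 hT δ
    refine ⟨P.gradingDer c + D, ?_⟩
    have hD : gradingCoeff h0 D = 0 := by
      change -zeroCoeff h0 (D.1 0 u₀) = 0
      rw [hu, map_zero, neg_zero]
    apply LieAlgebra.SemiDirectSum.ext
    · change gradingCoeff h0 (P.gradingDer c + D) = c
      rw [map_add, gradingCoeff_gradingDer, hD, add_zero]
    · change P.derRestrict (P.gradingDer c + D) = P.derRestrict D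
      rw [map_add, derRestrict_gradingDer, zero_add]

/-! ### Inner derivations of `P` and of `Ā`. -/

/-- Restrictions of inner derivations are inner. -/
theorem derRestrict_mem_algInnerDer (h0 : P.IsZeroUnit u₀) {D : P.Der} (hD : D ∈ P.innerDer) :
    P.derRestrict D ∈ algInnerDer 𝕜 P.augIdeal := by
  obtain ⟨lam, hlam⟩ := hD
  refine ⟨augProj h0 lam, fun a => Subtype.ext ?_⟩
  change D.1 1 a = (augProj h0 lam : P.obj 1) * a - a * (augProj h0 lam : P.obj 1)
  rw [hlam, adFun, Fin.sum_univ_one]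
  change lam * (a : P.obj 1) - a * lam = _
  conv_lhs => rw [← aug_smul_add_augProj h0 lam]
  change (aug h0 lam • (1 : P.obj 1) + augProj h0 lam) * (a : P.obj 1) -
    a * (aug h0 lam • (1 : P.obj 1) + augProj h0 lam) = _
  rw [add_mul, mul_add, smul_mul_assoc, mul_smul_comm, one_mul, mul_one]
  abel

theorem gradingDer_mem_innerDer (c : 𝕜) : P.gradingDer c ∈ P.innerDer :=
  ⟨-c • P.one, P.gradingDer_eq_adFun c⟩

/-- Erasing input `j` kills the summand `θ ∘ⱼ b`, since `b ∘₁ u₀ = 0`; the other summands, indexed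
by `j.succAbove`, become those of the erased element. -/
theorem erase_adFun {n : ℕ} (j : Fin (n + 1)) {b : P.obj 1} (hb : P.erase u₀ 0 b = 0)
    (θ : P.obj (n + 1)) :
    P.erase u₀ j (P.adFun b θ) = P.adFun b (P.erase u₀ j θ) := by
  rw [adFun, adFun, map_sub, map_sum, Fin.sum_univ_succAbove _ j,
    P.erase_comp_inner u₀ 0 j j _ (Nat.add_comm n 1) (by simp),
    P.erase_comp_inner u₀ j 0 j rfl rfl (by simp), hb, map_zero, zero_add]
  congr 1
  refine Finset.sum_congr rfl fun i _ => P.erase_comp_outer u₀ _ j i j rfl rfl ?_ θ b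
  rcases lt_or_ge (i : ℕ) j with h | h
  · exact Or.inl (by simp [Fin.succAbove, Fin.lt_def, h])
  · exact Or.inr (by simp [Fin.succAbove, Fin.lt_def, Nat.not_lt.2 h]; omega)

/-- Both sides vanish on `u₀`, agree on `P(1)` and commute with erasures, so separation by erasures
forces equality. -/
theorem derivation_eq_adFun (h0 : P.IsZeroUnit u₀) (hT : ∀ n, P.trunc u₀ 2 n = ⊥) (D : P.Der)
    (hu : D.1 0 u₀ = 0) (b : P.augIdeal)
    (hb : ∀ a, (P.derRestrict D).1 a = b * a - a * b) (n : ℕ) (θ : P.obj n) :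
    D.1 n θ = P.adFun (b : P.obj 1) θ := by
  have hb0 : P.erase u₀ 0 (b : P.obj 1) = 0 := (mem_augIdeal_iff h0).1 b.2
  induction n with
  | zero =>
    rw [← zeroCoeff_smul h0 θ, map_smul, hu, smul_zero, adFun, Fin.sum_univ_zero, sub_zero,
      map_smul]
    exact (smul_eq_zero_of_right _ hb0).symm
  | succ n ih =>
    cases n with
    | zero =>
      change P.obj 1 at θ
      have h : D.1 1 (augProj h0 θ : P.obj 1) =
          (b : P.obj 1) * augProj h0 θ - augProj h0 θ * (b : P.obj 1) :=
        congrArg (fun x : P.augIdeal => (x : P.obj 1)) (hb (augProj h0 θ))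
      change D.1 1 θ = P.comp 0 _ (b : P.obj 1) θ - ∑ i : Fin 1, P.comp i rfl θ (b : P.obj 1)
      rw [Fin.sum_univ_one]
      change D.1 1 θ = (b : P.obj 1) * θ - θ * (b : P.obj 1)
      conv_lhs => rw [← aug_smul_add_augProj h0 θ, map_add, map_smul, derivation_one, h]
      conv_rhs => rw [← aug_smul_add_augProj h0 θ]
      change _ = (b : P.obj 1) * (aug h0 θ • (1 : P.obj 1) + augProj h0 θ) -
        (aug h0 θ • (1 : P.obj 1) + augProj h0 θ) * (b : P.obj 1)
      rw [add_mul, mul_add, smul_mul_assoc, mul_smul_comm, one_mul, mul_one, smul_zero]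
      abel
    | succ n =>
      rw [← sub_eq_zero]
      refine eq_zero_of_erase_eq_zero hT fun j => ?_
      have h := D.2.2 _ _ _ j (rfl : n + 1 + 1 = n + 1 + 1 + 0) θ u₀
      rw [hu, map_zero, add_zero] at h
      rw [map_sub, erase_adFun j hb0, ← ih, sub_eq_zero]
      exact h.symm

theorem mem_innerDer_iff (h0 : P.IsZeroUnit u₀) (hT : ∀ n, P.trunc u₀ 2 n = ⊥) (D : P.Der) :
    D ∈ P.innerDer ↔ P.derRestrict D ∈ algInnerDer 𝕜 P.augIdeal := by
  refine ⟨derRestrict_mem_algInnerDer h0, ?_⟩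
  rintro ⟨b, hb⟩
  -- Subtracting the grading part makes the derivation kill `u₀`; the part removed is itself inner.
  have hinner : D - P.gradingDer (gradingCoeff h0 D) ∈ P.innerDer := by
    refine ⟨b, derivation_eq_adFun h0 hT _ ?_ b ?_⟩
    · change D.1 0 u₀ - (P.gradingDer (gradingCoeff h0 D)).1 0 u₀ = 0
      rw [derivation_zero_apply h0, derivation_zero_apply h0 (P.gradingDer _),
        gradingCoeff_gradingDer, sub_self]
    · rwa [map_sub, derRestrict_gradingDer, sub_zero]
  simpa using add_mem hinner (gradingDer_mem_innerDer (gradingCoeff h0 D))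

end Derivations

end SymmOperad

/-! ### Passage to quotients and the main theorem. -/

/-- A surjective morphism of Lie algebras induces an isomorphism modulo an ideal of the target
and its preimage. -/
theorem LieHom.exists_quotient_equiv {R : Type*} {L M : Type*} [CommRing R] [LieRing L]
    [LieAlgebra R L] [LieRing M] [LieAlgebra R M] (f : L →ₗ⁅R⁆ M) (hf : Function.Surjective f)
    (I : LieIdeal R L) (J : LieIdeal R M) (hIJ : ∀ x, x ∈ I ↔ f x ∈ J) :
    ∃ φ : (L ⧸ I) ≃ₗ⁅R⁆ (M ⧸ J), ∀ x : L,
      φ (LieSubmodule.Quotient.mk x) = LieSubmodule.Quotient.mk (f x) := by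
  let g : (L ⧸ I) →ₗ[R] (M ⧸ J) :=
    Submodule.mapQ I.toSubmodule J.toSubmodule f.toLinearMap fun x hx => (hIJ x).1 hx
  have hg : ∀ x : L, g (LieSubmodule.Quotient.mk x) = LieSubmodule.Quotient.mk (f x) :=
    fun _ => rfl
  have hbij : Function.Bijective g := by
    constructor
    · rw [injective_iff_map_eq_zero]
      rintro ⟨x⟩ hx
      exact (LieSubmodule.Quotient.mk_eq_zero I).2
        ((hIJ x).2 ((LieSubmodule.Quotient.mk_eq_zero J).1 hx))
    · rintro ⟨y⟩
      obtain ⟨x, rfl⟩ := hf y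
      exact ⟨LieSubmodule.Quotient.mk x, rfl⟩
  let g' : (L ⧸ I) →ₗ⁅R⁆ (M ⧸ J) :=
    { g with
      map_lie' := by
        rintro ⟨x⟩ ⟨y⟩
        change LieSubmodule.Quotient.mk (f ⁅x, y⁆) = LieSubmodule.Quotient.mk ⁅f x, f y⁆
        rw [LieHom.map_lie] }
  exact ⟨LieEquiv.ofBijective g' hbij, fun _ => rfl⟩

theorem theorem0p5 {𝕜 : Type u} [Field 𝕜] (P : SymmOperad.{u, v} 𝕜)
    (h2 : P.IsTwoUnitary)
    (hart : P.IsLeftArtinian ∨ P.IsRightArtinian)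
    (hsemi : P.IsSemiprime) :
    ∃ (ι : 𝕜 →ₗ⁅𝕜⁆ P.Der) (ρ : P.Der →ₗ⁅𝕜⁆ algDer 𝕜 P.augIdeal),
      (∀ (c : 𝕜) (n : ℕ) (θ : P.obj n), (ι c).1 n θ = (((n : 𝕜) - 1) * c) • θ) ∧
      (∀ (D : P.Der) (a : P.augIdeal), (((ρ D).1 a : P.augIdeal) : P.obj 1) = D.1 1 a) ∧
      Function.Injective ι ∧ Function.Exact ι ρ ∧ Function.Surjective ρ ∧
      (∃ (ψ : algDer 𝕜 P.augIdeal →ₗ⁅𝕜⁆ LieDerivation 𝕜 𝕜 𝕜)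
        (e : P.Der ≃ₗ⁅𝕜⁆ LieAlgebra.SemiDirectSum 𝕜 (algDer 𝕜 P.augIdeal) ψ),
        (∀ c, e (ι c) = LieAlgebra.SemiDirectSum.inl ψ c) ∧
        (∀ D, LieAlgebra.SemiDirectSum.projr ψ (e D) = ρ D)) ∧
      (∃ φ : P.H1 ≃ₗ⁅𝕜⁆ HH1 𝕜 P.augIdeal,
        ∀ D : P.Der, φ (LieSubmodule.Quotient.mk D) = LieSubmodule.Quotient.mk (ρ D)) := by
  obtain ⟨u₀, h0, u₂, hu₂⟩ := h2
  have hT := SymmOperad.trunc_two_eq_bot h0 hart hsemi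
  have hsurj : Function.Surjective P.derRestrict := fun δ =>
    (SymmOperad.exists_derivation_extending h0 hu₂ hT δ).imp fun _ h => h.2
  refine ⟨P.gradingDer, P.derRestrict, P.gradingDer_apply, P.coe_derRestrict_apply,
    Function.LeftInverse.injective (SymmOperad.gradingCoeff_gradingDer h0), fun D => ⟨fun hD =>
      ⟨_, (SymmOperad.derivation_eq_gradingDer h0 hT D hD).symm⟩, ?_⟩, hsurj,
    -- The action is zero: the semidirect sum is a direct product.
    ⟨0, LieEquiv.ofBijective _ (SymmOperad.derToSemiDirectSum_bijective h0 hu₂ hT),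
      fun c => ?_, fun D => rfl⟩,
    P.derRestrict.exists_quotient_equiv hsurj _ _ (SymmOperad.mem_innerDer_iff h0 hT)⟩
  · rintro ⟨c, rfl⟩
    exact P.derRestrict_gradingDer c
  · exact LieAlgebra.SemiDirectSum.ext (SymmOperad.gradingCoeff_gradingDer h0 c)
      (P.derRestrict_gradingDer c)
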